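/- Let $H=(V,E)$ be a hypergraph with finite vertex set $V$. A \emph{positive matching} of $H$ is a set $M\subseteq E$ of pairwise disjoint edges for which there is a weight function $w:V\to\mathbb{Q}$ with $\sum_{i\in e}w(i)>0$ for all $e\in M$ and $\sum_{i\in e}w(i)<0$ for all $e\in E\setminus M$. A \emph{positive matching decomposition} of $H$ with $p$ parts is a partition $E=M_1\cup\dots\cup M_p$ into pairwise disjoint sets such that, for each $i=1,\dots,p$, $M_i$ is a positive matching of $(V,E\setminus\bigcup_{j<i}M_j)$. The smallest $p$ for which such a decomposition exists is denoted $\mathrm{pmd}(H)$. $H$ is \emph{$r$-uniform} if every edge has exactly $r$ vertices. Let $r\ge 2$ be an integer. (a) If $r\ge 4$, then there is a polynomial $q$ with rational coefficients, depending only on $r$ and of degree at most $r-2$, such that for every $n \ge 0$ every $r$-uniform hypergraph $H$ on $n$ vertices satisfies $$\mathrm{pmd}(H)\le n^{r-1}+q(n).$$ (b) For every $r\ge 2$ (including $r=2,3$) there is a polynomial $P$ with rational coefficients, depending only on $r$ and of degree at most $r-1$, such that for every $n\ge 0$ every $r$-uniform hypergraph $H$ on $n$ vertices satisfies $\mathrm{pmd}(H)\le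 P(n)$. -/

import Mathlib

open Polynomial

universe u

namespace Hypergraph

variable {α : Type*}

/-- `H` is `r`-uniform: every edge has exactly `r` vertices. -/
def IsUniform (H : Hypergraph α) (r : ℕ) : Prop :=
  ∀ e ∈ H.edgeSet, e.encard = r

/-- `H` is a clutter: its edges are pairwise incomparable with respect to inclusion. -/
def IsClutter (H : Hypergraph α) : Prop :=
  IsAntichain (· ⊆ ·) H.edgeSet

/-- The hypergraph `(V, E \ F)`. -/
def removeEdges (H : Hypergraph α) (F : Set (Set α)) : Hypergraph α where
  vertexSet := H.vertexSet
  edgeSet := H.edgeSet \ F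
  subset_vertexSet_of_mem_edgeSet' := fun _ he => H.subset_vertexSet_of_mem_edgeSet' he.1

/-- `M` is a matching of `H`: a set of edges, any two distinct ones of which are disjoint. -/
def IsEdgeMatching (H : Hypergraph α) (M : Set (Set α)) : Prop :=
  M ⊆ H.edgeSet ∧ ∀ e ∈ M, ∀ e' ∈ M, e ≠ e' → e ∩ e' = ∅

/-- `M` is a positive matching of `H`: a matching for which there is a weight function that has a
positive sum on every edge in `M` and a negative sum on every other edge. Edges are finite in all
uses, so the sum over an edge is an honest finite sum; weights outside the vertex set play no
role. -/
def IsPositiveMatching (H : Hypergraph α) (M : Set (Set α)) : Prop :=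
  H.IsEdgeMatching M ∧ ∃ w : α → ℚ,
    (∀ e ∈ M, 0 < ∑ᶠ i ∈ e, w i) ∧ (∀ e ∈ H.edgeSet \ M, ∑ᶠ i ∈ e, w i < 0)

/-- The family `M₁, …, M_p` (indexed from `0`) is a positive matching decomposition of `H`. -/
structure IsPMDecomposition (H : Hypergraph α) {p : ℕ} (M : Fin p → Set (Set α)) : Prop where
  disjoint : ∀ i j, i ≠ j → M i ∩ M j = ∅
  union : ⋃ i, M i = H.edgeSet
  positive : ∀ i, (H.removeEdges (⋃ j, ⋃ (_ : j < i), M j)).IsPositiveMatching (M i)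

/-- The positive matching decomposition number of `H`: the smallest number of parts of a positive
matching decomposition of `H`. -/
noncomputable def pmd (H : Hypergraph α) : ℕ :=
  sInf {p | ∃ M : Fin p → Set (Set α), H.IsPMDecomposition M}

theorem IsUniform.isClutter {H : Hypergraph α} {r : ℕ} (h : H.IsUniform r) : H.IsClutter := by
  intro e he f hf hne hsub
  have hfin : f.Finite := Set.finite_of_encard_eq_coe (h f hf)
  exact hne (hfin.eq_of_subset_of_encard_le' hsub (by rw [h e he, h f hf]))

/-- A finite clutter without the empty edge has a positive matching decomposition, so that the
minimum in the definition of `pmd` is attained. -/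
theorem exists_isPMDecomposition_pmd {H : Hypergraph α} (hV : H.vertexSet.Finite)
    (hc : H.IsClutter) (h0 : ∅ ∉ H.edgeSet) :
    ∃ M : Fin H.pmd → Set (Set α), H.IsPMDecomposition M := by
  classical
  have hsub : ∀ e ∈ H.edgeSet, e ⊆ H.vertexSet := fun e he => H.subset_vertexSet_of_mem_edgeSet' he
  have hE : H.edgeSet.Finite := hV.finite_subsets.subset hsub
  have := hE.fintype
  have hne : {p | ∃ M : Fin p → Set (Set α), H.IsPMDecomposition M}.Nonempty := by
    let φ := (Fintype.equivFin H.edgeSet).symm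
    have hinj : ∀ i j, (φ i : Set α) = φ j → i = j := fun i j h => φ.injective (Subtype.ext h)
    refine ⟨Fintype.card H.edgeSet, fun i => {(φ i : Set α)}, ?_, ?_, ?_⟩
    · intro i j hij
      ext e
      simp only [Set.mem_inter_iff, Set.mem_singleton_iff, Set.mem_empty_iff_false, iff_false]
      rintro ⟨h1, h2⟩
      exact hij (hinj i j (h1.symm.trans h2))
    · ext e
      simp only [Set.mem_iUnion, Set.mem_singleton_iff]
      constructor
      · rintro ⟨i, rfl⟩
        exact (φ i).2
      · intro he
        exact ⟨φ.symm ⟨e, he⟩, by simp⟩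
    · intro i
      refine ⟨⟨?_, ?_⟩, ?_⟩
      · intro e he
        rw [Set.mem_singleton_iff] at he
        subst he
        refine ⟨(φ i).2, ?_⟩
        simp only [Set.mem_iUnion, Set.mem_singleton_iff, not_exists]
        intro j hj h
        exact hj.ne (hinj i j h).symm
      · rintro e rfl e' rfl h
        exact absurd rfl h
      · set e : Set α := (φ i : Set α) with he
        have heE : e ∈ H.edgeSet := (φ i).2
        let N : ℚ := H.vertexSet.ncard
        refine ⟨fun v => if v ∈ e then 1 else -(N + 1), ?_, ?_⟩
        · rintro f hf
          rw [Set.mem_singleton_iff] at hf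
          subst hf
          have hef : e.Finite := hV.subset (hsub e heE)
          rw [finsum_mem_eq_finite_toFinset_sum _ hef]
          refine Finset.sum_pos (fun v hv => ?_) ?_
          · rw [if_pos ((hef.mem_toFinset).1 hv)]
            exact one_pos
          · rw [Set.Finite.toFinset_nonempty, Set.nonempty_iff_ne_empty]
            intro h
            exact h0 (h ▸ heE)
        · rintro f ⟨⟨hfE, -⟩, hfe⟩
          rw [Set.mem_singleton_iff] at hfe
          have hff : f.Finite := hV.subset (hsub f hfE)
          obtain ⟨x, hxf, hxe⟩ := Set.not_subset.1 (hc hfE heE hfe)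
          rw [finsum_mem_eq_finite_toFinset_sum _ hff,
            ← Finset.add_sum_erase _ _ ((hff.mem_toFinset).2 hxf), if_neg hxe]
          have h1 : ∑ v ∈ hff.toFinset.erase x, (if v ∈ e then (1 : ℚ) else -(N + 1)) ≤
              ∑ v ∈ hff.toFinset.erase x, (1 : ℚ) := by
            refine Finset.sum_le_sum (fun v _ => ?_)
            have hN : 0 ≤ N := Nat.cast_nonneg _
            split_ifs <;> linarith
          have h2 : ∑ v ∈ hff.toFinset.erase x, (1 : ℚ) ≤ N := by
            rw [Finset.sum_const, nsmul_eq_mul, mul_one]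
            refine Nat.cast_le.2 ((Finset.card_le_card (Finset.erase_subset _ _)).trans ?_)
            rw [← Set.ncard_eq_toFinset_card f hff]
            exact Set.ncard_le_ncard (hsub f hfE) hV
          linarith
  exact Nat.sInf_mem hne

end Hypergraph

/-! Label the `n` vertices by 0, ..., n - 1 and list each edge decreasingly as v_0 > ... > v_m,
where r = m + 1. Classify edges by the vector of consecutive sums (v_0 + v_1, ..., v_{m-1} + v_m),
and remove the classes in increasing lexicographic order.

Each class is a matching. Half of the k-th sum separates the labels at position k from those at
position k + 1 across the whole class, so a shared vertex has the same position in both edges; its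
label then determines all the others through the sums.

Each class is positive among the edges that remain (`exists_weight_of_lex_le`). Weights vanishing on
the class are stacked with rapidly decreasing importance, so that an edge survives with sum zero
only if it passes every test: its vertices are covered by the class, they occupy the right
positions, and its sums equal the minimal ones. A final constant weight makes the class positive.

Hence `pmd` is at most the number of sum vectors. These are strictly decreasing in {0, ..., 2n - 1},
so there are at most C(2n, m) ≤ (2^m / m!) n^m of them. The constant is at most 1 for m ≥ 4; the
case m = 3 needs the finer count n^3 + n^2. -/

/-- Two weights can be combined into one whose sums along the tuples of a finite family are signed
lexicographically. -/
theorem exists_weight_refine {α β : Type*} {m : ℕ} {u : β → ℕ → α} {S M : Set β}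
    (hS : S.Finite) {Q Q' : β → Prop}
    (h : ∃ w : α → ℚ, (∀ e ∈ M, ∑ k ∈ Finset.range (m + 1), w (u e k) = 0) ∧
      ∀ f ∈ S, ∑ k ∈ Finset.range (m + 1), w (u f k) < 0 ∨
        (∑ k ∈ Finset.range (m + 1), w (u f k) = 0 ∧ Q f))
    (φ : α → ℚ) (hM : ∀ e ∈ M, ∑ k ∈ Finset.range (m + 1), φ (u e k) = 0)
    (hφ : ∀ f ∈ S, Q f → ∑ k ∈ Finset.range (m + 1), φ (u f k) < 0 ∨
        (∑ k ∈ Finset.range (m + 1), φ (u f k) = 0 ∧ Q' f)) :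
    ∃ w : α → ℚ, (∀ e ∈ M, ∑ k ∈ Finset.range (m + 1), w (u e k) = 0) ∧
      ∀ f ∈ S, ∑ k ∈ Finset.range (m + 1), w (u f k) < 0 ∨
        (∑ k ∈ Finset.range (m + 1), w (u f k) = 0 ∧ Q' f) := by
  obtain ⟨w, hw0, hw⟩ := h
  -- As `S` is finite, one large factor `N` keeps every negative `w`-sum dominant over the `φ`-sum;
  -- `φ` decides only where the `w`-sum is zero.
  have key : ∀ᶠ N : ℚ in Filter.atTop, ∀ f ∈ S,
      ∑ k ∈ Finset.range (m + 1), w (u f k) < 0 →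
        N * ∑ k ∈ Finset.range (m + 1), w (u f k) +
          ∑ k ∈ Finset.range (m + 1), φ (u f k) < 0 := by
    rw [Filter.eventually_all_finite hS]
    intro f _
    by_cases hneg : ∑ k ∈ Finset.range (m + 1), w (u f k) < 0
    · filter_upwards [Filter.eventually_gt_atTop
        ((∑ k ∈ Finset.range (m + 1), φ (u f k)) / -∑ k ∈ Finset.range (m + 1), w (u f k))]
        with N hN _
      rw [div_lt_iff₀ (by linarith)] at hN
      linarith
    · exact Filter.Eventually.of_forall fun N hN => absurd hN hneg
  obtain ⟨N, hN⟩ := key.exists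
  have hsum : ∀ f, ∑ k ∈ Finset.range (m + 1), (N * w (u f k) + φ (u f k)) =
      N * ∑ k ∈ Finset.range (m + 1), w (u f k) + ∑ k ∈ Finset.range (m + 1), φ (u f k) := by
    intro f
    rw [Finset.sum_add_distrib, Finset.mul_sum]
  refine ⟨fun a => N * w a + φ a, fun e he => ?_, fun f hf => ?_⟩
  · rw [hsum, hw0 e he, hM e he]
    ring
  · rw [hsum]
    rcases hw f hf with h | ⟨h, hQ⟩
    · exact Or.inl (hN f hf h)
    · rw [h, mul_zero, zero_add]
      exact hφ f hf hQ

/-! ### Separating the lexicographically smallest class by a weight -/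

section Weight

variable {α β : Type*} {m : ℕ} {g : α → ℕ} {u : β → ℕ → α} {S M : Set β} {x : ℕ → ℕ}

/-- Decreasing tuples with the same sums of consecutive entries have separated entries. -/
theorem label_lt_of_lt
    (hanti : ∀ e ∈ M, ∀ j k, j < k → k ≤ m → g (u e k) < g (u e j))
    (hx : ∀ e ∈ M, ∀ k < m, g (u e k) + g (u e (k + 1)) = x k)
    {e e' : β} (he : e ∈ M) (he' : e' ∈ M) {k l : ℕ} (hkl : k < l) (hl : l ≤ m) :
    g (u e l) < g (u e' k) := by
  -- The value `x k / 2` lies strictly between the label of `u e (k + 1)` and that of `u e' k`.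
  have h1 := hanti e he k (k + 1) (by omega) (by omega)
  have h2 := hanti e' he' k (k + 1) (by omega) (by omega)
  have h3 := hx e he k (by omega)
  have h4 := hx e' he' k (by omega)
  have h5 : g (u e l) ≤ g (u e (k + 1)) := by
    rcases eq_or_lt_of_le (Nat.succ_le_of_lt hkl) with h | h
    · rw [← h]
    · exact (hanti e he _ _ h hl).le
  omega

theorem index_eq_of_label_eq
    (hanti : ∀ e ∈ M, ∀ j k, j < k → k ≤ m → g (u e k) < g (u e j))
    (hx : ∀ e ∈ M, ∀ k < m, g (u e k) + g (u e (k + 1)) = x k)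
    {e e' : β} (he : e ∈ M) (he' : e' ∈ M) {k l : ℕ} (hk : k ≤ m) (hl : l ≤ m)
    (h : g (u e k) = g (u e' l)) : k = l := by
  rcases lt_trichotomy k l with hkl | hkl | hkl
  · exact absurd h (label_lt_of_lt hanti hx he' he hkl hl).ne'
  · exact hkl
  · exact absurd h (label_lt_of_lt hanti hx he he' hkl hk).ne

/-- Each prescribed sum lets an entry determine its neighbours, so one agreement propagates in both
directions. -/
theorem label_eq_of_label_eq
    (hx : ∀ e ∈ M, ∀ k < m, g (u e k) + g (u e (k + 1)) = x k)
    {e e' : β} (he : e ∈ M) (he' : e' ∈ M) {k : ℕ} (hk : k ≤ m)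
    (h : g (u e k) = g (u e' k)) {j : ℕ} (hj : j ≤ m) : g (u e j) = g (u e' j) := by
  have step : ∀ i < m, (g (u e i) = g (u e' i) ↔ g (u e (i + 1)) = g (u e' (i + 1))) := by
    intro i hi
    have h1 := hx e he i hi
    have h2 := hx e' he' i hi
    omega
  have zero : ∀ i ≤ m, (g (u e 0) = g (u e' 0) ↔ g (u e i) = g (u e' i)) := by
    intro i
    induction i with
    | zero => exact fun _ => Iff.rfl
    | succ i ih => exact fun hi => (ih (by omega)).trans (step i hi)
  exact (zero j hj).1 ((zero k hk).2 h)

/-- The sum of the weight equal to `-(m - k)` on index `k` and to `1` on larger indices. -/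
theorem sum_count_weight {ι : ℕ → ℕ} {k : ℕ} (hk : k ≤ m)
    (hlt : ∀ j < k, ι j = j) (heq : ι k = k) (hge : ∀ j, k < j → j ≤ m → k ≤ ι j) :
    ∑ j ∈ Finset.range (m + 1),
        (if ι j = k then -((m : ℚ) - k) else if k < ι j then 1 else 0) < 0 ∨
      (∑ j ∈ Finset.range (m + 1),
        (if ι j = k then -((m : ℚ) - k) else if k < ι j then 1 else 0) = 0 ∧
        ∀ j, k < j → j ≤ m → k < ι j) := by
  obtain ⟨d, rfl⟩ := Nat.exists_eq_add_of_le hk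
  rw [show k + d + 1 = (k + 1) + d by ring, Finset.sum_range_add, Finset.sum_range_succ,
    Finset.sum_eq_zero (s := Finset.range k), if_pos heq]
  · have hle : ∀ i ∈ Finset.range d, (if ι (k + 1 + i) = k then -(((k + d : ℕ) : ℚ) - k)
        else if k < ι (k + 1 + i) then 1 else 0) ≤ (1 : ℚ) := by
      intro i _
      push_cast
      have : (0 : ℚ) ≤ d := Nat.cast_nonneg d
      split_ifs <;> linarith
    -- The `d` later positions contribute at most 1 each, just balancing `-d` at position `k`; a
    -- later entry of index `k` breaks the balance.
    by_cases hall : ∀ j, k < j → j ≤ k + d → k < ι j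
    · right
      refine ⟨?_, hall⟩
      rw [Finset.sum_congr rfl (g := fun _ => (1 : ℚ))]
      · simp
      · intro i hi
        rw [Finset.mem_range] at hi
        have := hall (k + 1 + i) (by omega) (by omega)
        rw [if_neg (by omega), if_pos this]
    · left
      push Not at hall
      obtain ⟨j, hj1, hj2, hj3⟩ := hall
      obtain ⟨i, rfl⟩ := Nat.exists_eq_add_of_lt hj1
      have h1 : ι (k + 1 + i) = k := by
        have := hge _ hj1 hj2
        rw [show k + 1 + i = k + i + 1 by ring]
        omega
      have hlt' := Finset.sum_lt_sum hle ⟨i, Finset.mem_range.2 (by omega), by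
        rw [if_pos h1]
        push_cast
        have : (0 : ℚ) ≤ d := Nat.cast_nonneg d
        linarith⟩
      rw [Finset.sum_const, Finset.card_range, nsmul_eq_mul, mul_one] at hlt'
      push_cast at hlt' ⊢
      linarith
  · intro j hj
    rw [Finset.mem_range] at hj
    rw [hlt j hj, if_neg (by omega), if_neg (by omega)]

/-- The sum of the weight equal to `c - y` on index `k` and to `-y` on index `k + 1`. -/
theorem sum_pair_weight {ι : ℕ → ℕ} (y : ℕ → ℚ) (c : ℚ) {k : ℕ} (hk : k < m)
    (hle : ∀ j ≤ k + 1, ι j = j) (hge : ∀ j, k + 1 < j → j ≤ m → k + 1 < ι j) :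
    ∑ j ∈ Finset.range (m + 1), (if ι j = k then c - y j else if ι j = k + 1 then -y j else 0) =
      c - y k - y (k + 1) := by
  rw [← Finset.sum_subset (s₁ := {k, k + 1})]
  · rw [Finset.sum_pair (by omega), if_pos (hle k (by omega)), hle (k + 1) le_rfl,
      if_neg (by omega), if_pos rfl]
    ring
  · intro j hj
    simp only [Finset.mem_insert, Finset.mem_singleton] at hj
    rw [Finset.mem_range]
    omega
  · intro j hj hj'
    rw [Finset.mem_range] at hj
    simp only [Finset.mem_insert, Finset.mem_singleton, not_or] at hj'
    rcases le_or_gt j (k + 1) with h | h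
    · rw [hle j h, if_neg hj'.1, if_neg hj'.2]
    · have := hge j h (by omega)
      rw [if_neg (by omega), if_neg (by omega)]

/-- In a finite family of decreasing tuples, the tuples with the lexicographically smallest sequence
of sums of consecutive entries can be separated from the others by a weight. -/
theorem exists_weight_of_lex_le (hm : 1 ≤ m) (hS : S.Finite)
    (hanti : ∀ e ∈ S, ∀ j k, j < k → k ≤ m → g (u e k) < g (u e j))
    (hx : ∀ f ∈ S, (∀ k < m, g (u f k) + g (u f (k + 1)) = x k) ∨
      ∃ k < m, (∀ j < k, g (u f j) + g (u f (j + 1)) = x j) ∧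
        x k < g (u f k) + g (u f (k + 1))) :
    ∃ w : α → ℚ, ∀ f ∈ S,
      ((∀ k < m, g (u f k) + g (u f (k + 1)) = x k) →
        0 < ∑ k ∈ Finset.range (m + 1), w (u f k)) ∧
      (¬ (∀ k < m, g (u f k) + g (u f (k + 1)) = x k) →
        ∑ k ∈ Finset.range (m + 1), w (u f k) < 0) := by
  classical
  set M : Set β := {f ∈ S | ∀ k < m, g (u f k) + g (u f (k + 1)) = x k}
  have hantiM : ∀ e ∈ M, ∀ j k, j < k → k ≤ m → g (u e k) < g (u e j) :=
    fun e he => hanti e he.1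
  have hxM : ∀ e ∈ M, ∀ k < m, g (u e k) + g (u e (k + 1)) = x k := fun e he => he.2
  have hlex : ∀ f ∈ S, ∀ k < m, (∀ j < k, g (u f j) + g (u f (j + 1)) = x j) →
      x k ≤ g (u f k) + g (u f (k + 1)) := by
    intro f hf k hk hj
    rcases hx f hf with h | ⟨l, hl, hl1, hl2⟩
    · exact (h k hk).ge
    · rcases lt_trichotomy k l with h | h | h
      · exact (hl1 k h).ge
      · exact h ▸ hl2.le
      · exact absurd (hj l h) hl2.ne'
  -- The position of a vertex in the tuples of `M`, well defined by `index_eq_of_label_eq`. The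
  -- default 0 is harmless: tuples using uncovered vertices are made negative first.
  let ι : α → ℕ := fun a => if h : ∃ k ≤ m, ∃ e ∈ M, u e k = a then h.choose else 0
  have hι : ∀ e ∈ M, ∀ k ≤ m, ι (u e k) = k := by
    intro e he k hk
    have h : ∃ k' ≤ m, ∃ e' ∈ M, u e' k' = u e k := ⟨k, hk, e, he, rfl⟩
    obtain ⟨h1, e', he', h2⟩ := h.choose_spec
    have : ι (u e k) = h.choose := dif_pos h
    rw [this]
    exact index_eq_of_label_eq hantiM hxM he' he h1 hk (by rw [h2])
  let In : β → Prop := fun f => ∀ j ≤ m, ∃ l ≤ m, ∃ e ∈ M, u e l = u f j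
  -- What a tuple of sum zero has passed by stage `k`: positions up to `k` are right, but only the
  -- sums before the `k`-th are, since the `k`-th also involves position `k + 1`.
  let P : ℕ → β → Prop := fun k f => In f ∧ (∀ j ≤ k, ι (u f j) = j) ∧
    (∀ j, k < j → j ≤ m → k < ι (u f j)) ∧ ∀ j < k, g (u f j) + g (u f (j + 1)) = x j
  have hA : ∀ k ≤ m, ∀ e ∈ M, ∑ j ∈ Finset.range (m + 1),
      (if ι (u e j) = k then -((m : ℚ) - k) else if k < ι (u e j) then 1 else 0) = 0 := by
    intro k hk e he
    have hlt : ∀ j, k < j → j ≤ m → k < ι (u e j) := fun j h1 h2 => by rwa [hι e he j h2]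
    obtain ⟨d, rfl⟩ := Nat.exists_eq_add_of_le hk
    rw [Finset.sum_congr rfl (g := fun j : ℕ =>
      if j = k then -(((k + d : ℕ) : ℚ) - k) else if k < j then 1 else 0)]
    · rw [show k + d + 1 = (k + 1) + d by ring, Finset.sum_range_add, Finset.sum_range_succ,
        Finset.sum_eq_zero (s := Finset.range k), if_pos rfl,
        Finset.sum_congr rfl (g := fun _ => (1 : ℚ))]
      · simp
      · intro i _
        rw [if_neg (by omega), if_pos (by omega)]
      · intro i hi
        rw [Finset.mem_range] at hi
        rw [if_neg (by omega), if_neg (by omega)]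
    · intro j hj
      rw [Finset.mem_range] at hj
      simp only [hι e he j (by omega)]
  have hB : ∀ k < m, ∀ e ∈ M, ∑ j ∈ Finset.range (m + 1),
      (if ι (u e j) = k then (x k : ℚ) - g (u e j)
        else if ι (u e j) = k + 1 then -(g (u e j) : ℚ) else 0) = 0 := by
    intro k hk e he
    rw [sum_pair_weight (ι := fun j => ι (u e j)) (fun j => (g (u e j) : ℚ)) (x k) hk
      (fun j hj => hι e he j (by omega)) (fun j h1 h2 => by rwa [hι e he j h2])]
    rw [← hxM e he k hk]
    push_cast
    ring
  have main : ∀ k ≤ m, ∃ w : α → ℚ, (∀ e ∈ M, ∑ j ∈ Finset.range (m + 1), w (u e j) = 0) ∧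
      ∀ f ∈ S, ∑ j ∈ Finset.range (m + 1), w (u f j) < 0 ∨
        (∑ j ∈ Finset.range (m + 1), w (u f j) = 0 ∧ P k f) := by
    intro k
    induction k with
    | zero =>
      intro _
      refine exists_weight_refine (Q := In) hS ?_
        (fun a => if ι a = 0 then -((m : ℚ) - (0 : ℕ)) else if 0 < ι a then 1 else 0)
        (hA 0 (by omega)) ?_
      -- The dominant weight penalizes every vertex not covered by `M`.
      · refine ⟨fun a => if ∃ l ≤ m, ∃ e ∈ M, u e l = a then 0 else -1, fun e he => ?_,
          fun f _ => ?_⟩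
        · refine Finset.sum_eq_zero fun j hj => if_pos ⟨j, ?_, e, he, rfl⟩
          rw [Finset.mem_range] at hj
          omega
        · by_cases hf : In f
          · right
            refine ⟨Finset.sum_eq_zero fun j hj => if_pos (hf j ?_), hf⟩
            rw [Finset.mem_range] at hj
            omega
          · left
            simp only [In] at hf
            push Not at hf
            obtain ⟨j, hj, hj'⟩ := hf
            refine Finset.sum_neg' (fun i _ => ?_) ⟨j, Finset.mem_range.2 (by omega), ?_⟩
            · beta_reduce
              split_ifs <;> norm_num
            · beta_reduce
              rw [if_neg]
              · norm_num
              · rintro ⟨l, hl, e, he, h⟩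
                exact hj' l hl e he h
      · intro f hf hIn
        have h0 : ι (u f 0) = 0 := by
          obtain ⟨l, hl, e, he, h⟩ := hIn 0 (by omega)
          rw [← h, hι e he l hl]
          -- An index `l ≥ 1` would put the largest label of `f` below `x 0 / 2`, making its first
          -- sum smaller than the minimum `x 0`.
          by_contra hl0
          have h1 := hlex f hf 0 (by omega) (by intro j hj; omega)
          have h2 := hanti f hf 0 1 (by omega) hm
          have h3 := label_lt_of_lt hantiM hxM he he (Nat.pos_of_ne_zero hl0) hl
          have h4 := hxM e he 0 (by omega)
          have h5 : g (u e l) ≤ g (u e (0 + 1)) := by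
            rcases eq_or_lt_of_le (Nat.one_le_iff_ne_zero.2 hl0) with h' | h'
            · rw [← h']
            · exact (hantiM e he _ _ h' hl).le
          have h6 := hantiM e he 0 1 (by omega) hm
          rw [← h] at h1 h2
          simp only [zero_add] at *
          omega
        rcases sum_count_weight (m := m) (ι := fun j => ι (u f j)) (k := 0) (by omega)
          (by intro j hj; omega) h0 (fun _ _ _ => Nat.zero_le _) with h | ⟨h, h'⟩
        · exact Or.inl h
        · refine Or.inr ⟨h, hIn, fun j hj => ?_, h', fun j hj => by omega⟩
          rw [Nat.le_zero.1 hj, h0]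
    | succ k ih =>
      intro hk
      -- Two refinements per stage: the counting weight fixes position `k + 1` and gives `Q`; the
      -- pair weight then has sum `x k` minus the `k`-th sum, which is nonpositive by minimality.
      let Q : β → Prop := fun f => In f ∧ (∀ j ≤ k + 1, ι (u f j) = j) ∧
        (∀ j, k + 1 < j → j ≤ m → k + 1 < ι (u f j)) ∧
        ∀ j < k, g (u f j) + g (u f (j + 1)) = x j
      refine exists_weight_refine (Q := Q) hS
        (exists_weight_refine (Q := P k) hS (ih (by omega))
          (fun a => if ι a = k + 1 then -((m : ℚ) - (k + 1 : ℕ))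
            else if k + 1 < ι a then 1 else 0) (hA (k + 1) hk) ?_)
        (fun a => if ι a = k then (x k : ℚ) - g a else if ι a = k + 1 then -(g a : ℚ) else 0)
        (hB k hk) ?_
      · rintro f hf ⟨hIn, hle, hgt, hsum⟩
        have h1 : ι (u f (k + 1)) = k + 1 := by
          obtain ⟨l, hl, e, he, h⟩ := hIn (k + 1) hk
          have hl' : k < l := by
            rw [← hι e he l hl, h]
            exact hgt _ (by omega) hk
          rw [← h, hι e he l hl]
          -- An index beyond `k + 1` would give position `k + 1` too small a label, and the `k`-th
          -- sum would drop below `x k`.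
          by_contra hne
          obtain ⟨l', hl1, e', he', h'⟩ := hIn k (by omega)
          have h2 : l' = k := by rw [← hι e' he' l' hl1, h', hle k le_rfl]
          subst h2
          have h3 := hlex f hf l' hk hsum
          have h4 := label_lt_of_lt hantiM hxM he he' (k := l' + 1) (l := l) (by omega) hl
          have h5 := hxM e' he' l' hk
          rw [← h, ← h'] at h3
          omega
        rcases sum_count_weight (m := m) (ι := fun j => ι (u f j)) (k := k + 1) hk
          (fun j hj => hle j (by omega)) h1
          (fun j hj hj' => hgt j (by omega) hj') with h | ⟨h, h'⟩
        · exact Or.inl h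
        · refine Or.inr ⟨h, hIn, fun j hj => ?_, h', hsum⟩
          rcases eq_or_lt_of_le hj with rfl | hj
          · exact h1
          · exact hle j (by omega)
      · rintro f hf ⟨hIn, hle, hgt, hsum⟩
        rw [sum_pair_weight (ι := fun j => ι (u f j)) (fun j => (g (u f j) : ℚ)) (x k) hk
          hle hgt]
        have h1 := hlex f hf k hk hsum
        rcases eq_or_lt_of_le h1 with h | h
        · refine Or.inr ⟨?_, hIn, hle, hgt, fun j hj => ?_⟩
          · rw [h]
            push_cast
            ring
          · rcases eq_or_lt_of_le (Nat.le_of_lt_succ hj) with rfl | hj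
            · exact h.symm
            · exact hsum j hj
        · left
          have : (x k : ℚ) < g (u f k) + g (u f (k + 1)) := by exact_mod_cast h
          linarith
  obtain ⟨w, hw0, hw⟩ := main m le_rfl
  have key : ∀ᶠ N : ℚ in Filter.atTop, ∀ f ∈ S,
      ∑ k ∈ Finset.range (m + 1), w (u f k) < 0 →
        N * ∑ k ∈ Finset.range (m + 1), w (u f k) + (m + 1) < 0 := by
    rw [Filter.eventually_all_finite hS]
    intro f _
    by_cases hneg : ∑ k ∈ Finset.range (m + 1), w (u f k) < 0
    · filter_upwards [Filter.eventually_gt_atTop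
        (((m : ℚ) + 1) / -∑ k ∈ Finset.range (m + 1), w (u f k))] with N hN _
      rw [div_lt_iff₀ (by linarith)] at hN
      linarith
    · exact Filter.Eventually.of_forall fun N hN => absurd hN hneg
  obtain ⟨N, hN⟩ := key.exists
  have hsum : ∀ f, ∑ k ∈ Finset.range (m + 1), (N * w (u f k) + 1) =
      N * ∑ k ∈ Finset.range (m + 1), w (u f k) + (m + 1) := by
    intro f
    rw [Finset.sum_add_distrib, Finset.mul_sum]
    simp
  -- Adding 1 at each vertex lifts the zero sums on `M` to `m + 1`, while a large `N` keeps the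
  -- others negative.
  refine ⟨fun a => N * w a + 1, fun f hf => ⟨fun h => ?_, fun h => ?_⟩⟩
  · rw [hsum, hw0 f ⟨hf, h⟩, mul_zero, zero_add]
    positivity
  · rw [hsum]
    rcases hw f hf with h' | ⟨-, -, -, -, h'⟩
    · exact hN f hf h'
    · exact absurd h' h

end Weight

/-! ### From ordered classes of edges to positive matching decompositions -/

namespace Hypergraph

/-- If the edges are classified by a linearly ordered type so that every class is a positive
matching once the edges of all smaller classes are removed, then the number of classes bounds
the positive matching decomposition number. -/
theorem pmd_le_card {α L : Type*} [LinearOrder L] (H : Hypergraph α) (c : Set α → L)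
    (T : Finset L) (hT : ∀ e ∈ H.edgeSet, c e ∈ T)
    (h : ∀ x, (H.removeEdges {e | c e < x}).IsPositiveMatching {e ∈ H.edgeSet | c e = x}) :
    H.pmd ≤ T.card := by
  set t := T.orderEmbOfFin rfl
  have hsurj : ∀ e ∈ H.edgeSet, ∃ i, t i = c e := by
    intro e he
    have : c e ∈ Set.range t := by
      rw [Finset.range_orderEmbOfFin]
      exact hT e he
    exact this
  refine Nat.sInf_le ⟨fun i => {e ∈ H.edgeSet | c e = t i}, ?_, ?_, fun i => ?_⟩
  · intro i j hij
    ext e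
    simp only [Set.mem_inter_iff, Set.mem_ofPred_eq, Set.mem_empty_iff_false, iff_false]
    rintro ⟨⟨-, h1⟩, -, h2⟩
    exact hij (t.injective (h1.symm.trans h2))
  · ext e
    simp only [Set.mem_iUnion, Set.mem_ofPred_eq]
    constructor
    · rintro ⟨i, he, -⟩
      exact he
    · intro he
      obtain ⟨i, hi⟩ := hsurj e he
      exact ⟨i, he, hi.symm⟩
  · have heq : H.removeEdges (⋃ j, ⋃ (_ : j < i), {e ∈ H.edgeSet | c e = t j}) =
        H.removeEdges {e | c e < t i} := by
      refine Hypergraph.ext rfl ?_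
      ext e
      simp only [removeEdges, Set.mem_sdiff, Set.mem_iUnion, Set.mem_ofPred_eq, not_exists]
      refine and_congr_right fun he => ⟨fun h' hlt => ?_, fun h' j hj hj' => ?_⟩
      · obtain ⟨j, hj⟩ := hsurj e he
        exact h' j (t.lt_iff_lt.1 (hj ▸ hlt)) ⟨he, hj.symm⟩
      · exact h' (hj'.2 ▸ t.lt_iff_lt.2 hj)
    rw [heq]
    exact h (t i)

/-- The edges of a finite uniform hypergraph with labelled vertices, listed by decreasing label. -/
theorem IsUniform.exists_decreasing_tuple {α : Type*} [Nonempty α] {H : Hypergraph α} {m : ℕ}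
    (hH : H.IsUniform (m + 1)) {g : α → ℕ} (hg : Set.InjOn g H.vertexSet) :
    ∃ u : Set α → ℕ → α, ∀ e ∈ H.edgeSet,
      (∀ j k, j < k → k ≤ m → g (u e k) < g (u e j)) ∧ u e '' Set.Iic m = e := by
  classical
  have key : ∀ e ∈ H.edgeSet, ∃ v : ℕ → α,
      (∀ j k, j < k → k ≤ m → g (v k) < g (v j)) ∧ v '' Set.Iic m = e := by
    intro e he
    have hfin : e.Finite := Set.finite_of_encard_eq_coe (hH e he)
    have hge : Set.InjOn g e := hg.mono (H.subset_vertexSet_of_mem_edgeSet he)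
    have hcard : (hfin.toFinset.image g).card = m + 1 := by
      rw [Finset.card_image_of_injOn (by simpa using hge)]
      have := hH e he
      rw [hfin.encard_eq_coe_toFinset_card] at this
      exact_mod_cast this
    set t := (hfin.toFinset.image g).orderEmbOfFin hcard
    have ht : ∀ i, ∃ a ∈ e, g a = t i := by
      intro i
      obtain ⟨a, ha, hga⟩ := Finset.mem_image.1 (Finset.orderEmbOfFin_mem _ hcard i)
      exact ⟨a, hfin.mem_toFinset.1 ha, hga⟩
    choose a hae hga using ht
    -- `t` enumerates the labels increasingly, hence the reversal; values at `k > m` are junk.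
    refine ⟨fun k => a (Fin.rev (Fin.ofNat (m + 1) k)), fun j k hjk hk => ?_, ?_⟩
    · rw [hga, hga]
      refine t.lt_iff_lt.2 (Fin.rev_lt_rev.2 ?_)
      rw [Fin.lt_def, Fin.val_ofNat, Fin.val_ofNat, Nat.mod_eq_of_lt (by omega),
        Nat.mod_eq_of_lt (by omega)]
      exact hjk
    · ext b
      constructor
      · rintro ⟨k, -, rfl⟩
        exact hae _
      · intro hb
        have hb' : g b ∈ Set.range t := by
          rw [Finset.range_orderEmbOfFin]
          simpa using ⟨b, hb, rfl⟩
        obtain ⟨i, hi⟩ := hb'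
        refine ⟨(Fin.rev i : Fin (m + 1)), Nat.le_of_lt_succ (Fin.rev i).2, ?_⟩
        refine hge (hae _) hb ?_
        have : Fin.ofNat (m + 1) (Fin.rev i : Fin (m + 1)) = Fin.rev i := Fin.ext (by
          rw [Fin.val_ofNat, Nat.mod_eq_of_lt (Fin.rev i).2])
        rw [hga, this, Fin.rev_rev, hi]
  choose! u hu using key
  exact ⟨u, hu⟩

/-- The positive matching decomposition number of a finite uniform hypergraph is at most the number
of sequences of sums of consecutive labels along its edges. -/
theorem IsUniform.exists_pmd_le_ncard {α : Type*} {H : Hypergraph α} {n m : ℕ}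
    (hV : H.vertexSet.encard = n) (hm : 1 ≤ m) (hH : H.IsUniform (m + 1)) :
    ∃ v : Set α → ℕ → ℕ,
      (∀ e ∈ H.edgeSet, (∀ j k, j < k → k ≤ m → v e k < v e j) ∧ ∀ k ≤ m, v e k < n) ∧
      H.pmd ≤ ((fun e => fun k : Fin m => v e k + v e (k + 1)) '' H.edgeSet).ncard := by
  classical
  have hVfin : H.vertexSet.Finite := Set.finite_of_encard_eq_coe hV
  have hsub : ∀ e ∈ H.edgeSet, e ⊆ H.vertexSet := fun e he => H.subset_vertexSet_of_mem_edgeSet he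
  have hE : H.edgeSet.Finite := hVfin.finite_subsets.subset hsub
  rcases H.edgeSet.eq_empty_or_nonempty with hemp | ⟨e₀, he₀⟩
  · refine ⟨fun _ _ => 0, fun e he => absurd he (by simp [hemp]), ?_⟩
    exact (Nat.sInf_le ⟨Fin.elim0, fun i => i.elim0, by simp [hemp], fun i => i.elim0⟩ :
      H.pmd ≤ 0).trans (Nat.zero_le _)
  have : Nonempty α := by
    obtain ⟨a, -⟩ : e₀.Nonempty := by
      rw [← Set.encard_ne_zero, hH e₀ he₀]
      exact_mod_cast Nat.succ_ne_zero m
    exact ⟨a⟩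
  obtain ⟨g, hgn, hg⟩ : ∃ g : α → ℕ, (∀ a ∈ H.vertexSet, g a < n) ∧
      Set.InjOn g H.vertexSet := by
    have hcard : (Set.Iio n).encard = n := by
      rw [← Finset.coe_Iio, Set.encard_coe_eq_coe_finsetCard, Nat.card_Iio]
    obtain ⟨g, hg⟩ := hVfin.exists_bijOn_of_encard_eq (hV.trans hcard.symm)
    exact ⟨g, fun a ha => hg.mapsTo ha, hg.injOn⟩
  obtain ⟨u, hu⟩ := hH.exists_decreasing_tuple hg
  have hmem : ∀ e ∈ H.edgeSet, ∀ k ≤ m, u e k ∈ e := fun e he k hk => by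
    have : u e k ∈ u e '' Set.Iic m := ⟨k, hk, rfl⟩
    rwa [(hu e he).2] at this
  have hinj : ∀ e ∈ H.edgeSet, Set.InjOn (u e) (Set.Iic m) := by
    intro e he j hj k hk hjk
    rcases lt_trichotomy j k with h | h | h
    · exact absurd (congrArg g hjk) ((hu e he).1 j k h hk).ne'
    · exact h
    · exact absurd (congrArg g hjk) ((hu e he).1 k j h hj).ne
  have hsum : ∀ e ∈ H.edgeSet, ∀ w : α → ℚ,
      ∑ᶠ i ∈ e, w i = ∑ k ∈ Finset.range (m + 1), w (u e k) := by
    intro e he w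
    have h1 : (Finset.range (m + 1) : Set ℕ) = Set.Iic m := by
      ext k
      simp
    conv_lhs => rw [← (hu e he).2]
    rw [finsum_mem_image (hinj e he), ← h1, finsum_mem_coe_finset]
  refine ⟨fun e k => g (u e k), fun e he => ⟨(hu e he).1, fun k hk =>
    hgn _ (hsub e he (hmem e he k hk))⟩, ?_⟩
  let s : Set α → Fin m → ℕ := fun e k => g (u e k) + g (u e (k + 1))
  change H.pmd ≤ (s '' H.edgeSet).ncard
  have hT : ((hE.toFinset.image s).map toLex.toEmbedding).card = (s '' H.edgeSet).ncard := by
    rw [Finset.card_map, ← Set.ncard_coe_finset]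
    simp
  rw [← hT]
  refine pmd_le_card H (fun e => toLex (s e)) _ (fun e he => ?_) (fun x => ?_)
  · simpa using ⟨e, he, rfl⟩
  let y : ℕ → ℕ := fun k => if h : k < m then ofLex x ⟨k, h⟩ else 0
  have hy : ∀ e, toLex (s e) = x ↔ ∀ k < m, g (u e k) + g (u e (k + 1)) = y k := by
    intro e
    constructor
    · rintro h k hk
      simp only [y, dif_pos hk, ← h]
      rfl
    · intro h
      refine ofLex.injective (funext fun k => ?_)
      have := h k k.2
      simp only [y, dif_pos k.2] at this
      exact this
  -- The edges remaining when class `x` is reached are those with sum vector at least `x`, so `x` is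
  -- a lower bound among them.
  obtain ⟨w, hw⟩ := exists_weight_of_lex_le (g := g) (u := u) (x := y)
    (S := {e ∈ H.edgeSet | x ≤ toLex (s e)}) hm (hE.subset (Set.sep_subset _ _))
    (fun e he => (hu e he.1).1) (by
      rintro f ⟨hf, hle⟩
      rcases hle.eq_or_lt with h | h
      · exact Or.inl ((hy f).1 h.symm)
      · obtain ⟨k, hk1, hk2⟩ := h
        refine Or.inr ⟨k, k.2, fun j hj => ?_, ?_⟩
        · have := hk1 ⟨j, hj.trans k.2⟩ hj
          simp only [y, dif_pos (hj.trans k.2)]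
          exact this.symm
        · simp only [y, dif_pos k.2]
          exact hk2)
  refine ⟨⟨fun e he => ⟨he.1, ?_⟩, ?_⟩, w, fun e he => ?_, ?_⟩
  · simp [he.2]
  · rintro e ⟨he, hex⟩ e' ⟨he', hex'⟩ hne
    by_contra hcon
    obtain ⟨a, hae, hae'⟩ := Set.nonempty_iff_ne_empty.2 hcon
    have hM1 : ∀ f ∈ ({e, e'} : Set (Set α)), ∀ j k, j < k → k ≤ m → g (u f k) < g (u f j) := by
      rintro f (rfl | rfl)
      · exact (hu _ he).1
      · exact (hu _ he').1
    have hM2 : ∀ f ∈ ({e, e'} : Set (Set α)), ∀ k < m, g (u f k) + g (u f (k + 1)) = y k := by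
      rintro f (rfl | rfl)
      · exact (hy _).1 hex
      · exact (hy _).1 hex'
    rw [← (hu e he).2] at hae
    rw [← (hu e' he').2] at hae'
    obtain ⟨k, hk, hka⟩ := hae
    obtain ⟨l, hl, hla⟩ := hae'
    have hgkl : g (u e k) = g (u e' l) := by rw [hka, hla]
    have hkl : k = l := index_eq_of_label_eq hM1 hM2 (by simp) (by simp) hk hl hgkl
    subst hkl
    have hall : ∀ j ∈ Set.Iic m, u e j = u e' j := fun j hj =>
      hg (hsub e he (hmem e he j hj)) (hsub e' he' (hmem e' he' j hj))
        (label_eq_of_label_eq hM2 (by simp) (by simp) hk hgkl hj)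
    exact hne (by rw [← (hu e he).2, ← (hu e' he').2, Set.image_congr hall])
  · rw [hsum e he.1]
    exact (hw e ⟨he.1, he.2.ge⟩).1 ((hy e).1 he.2)
  · rintro e ⟨⟨he, hlt⟩, hne⟩
    rw [hsum e he]
    exact (hw e ⟨he, not_lt.1 hlt⟩).2 fun h => hne ⟨he, (hy e).2 h⟩

end Hypergraph

/-! ### Counting sum vectors -/

theorem ncard_strictAnti_le_choose {m N : ℕ} {A : Set (Fin m → ℕ)}
    (hA : ∀ s ∈ A, StrictAnti s ∧ ∀ k, s k < N) : A.ncard ≤ N.choose m := by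
  classical
  have hcard : (Finset.powersetCard m (Finset.range N)).card = N.choose m := by
    rw [Finset.card_powersetCard, Finset.card_range]
  rw [← hcard, ← Set.ncard_coe_finset]
  refine Set.ncard_le_ncard_of_injOn (fun s => Finset.univ.image s) (fun s hs => ?_) ?_
    (Finset.finite_toSet _)
  · rw [Finset.mem_coe, Finset.mem_powersetCard]
    refine ⟨fun a ha => ?_, ?_⟩
    · obtain ⟨k, -, rfl⟩ := Finset.mem_image.1 ha
      exact Finset.mem_range.2 ((hA s hs).2 k)
    · rw [Finset.card_image_of_injective _ (hA s hs).1.injective, Finset.card_univ,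
        Fintype.card_fin]
  · intro s hs s' hs' h
    have hr : Set.range s = Set.range s' := by
      have := congrArg (fun F : Finset ℕ => (F : Set ℕ)) h
      simpa using this
    -- A strictly monotone sequence is determined by its range; reversal transfers this to
    -- decreasing ones.
    have hrev : ∀ f : Fin m → ℕ, Set.range (f ∘ Fin.rev) = Set.range f := fun f =>
      Fin.rev_surjective.range_comp f
    have hmono : ∀ f : Fin m → ℕ, StrictAnti f → StrictMono (f ∘ Fin.rev) := fun f hf =>
      hf.comp Fin.rev_strictAnti
    have := ((hmono s (hA s hs).1).range_inj (hmono s' (hA s' hs').1)).1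
      (by rw [hrev, hrev, hr])
    funext k
    have h' := congrFun this (Fin.rev k)
    simpa using h'

/-- The sums of consecutive entries of decreasing quadruples in `{0, ..., n - 1}` take few values. -/
theorem ncard_sums_quadruples_le {n : ℕ} {A : Set (Fin 3 → ℕ)}
    (hA : ∀ s ∈ A, ∃ a b c d, d < c ∧ c < b ∧ b < a ∧ a < n ∧ s = ![a + b, b + c, c + d]) :
    A.ncard ≤ n ^ 3 + n ^ 2 := by
  classical
  -- The vector is encoded by (a - c, b - d) and b + c. Both differences are below `n`, while b - d
  -- ≤ b + c, and a + b < 2n gives b + c < 2n - (a - c). Summing the interval lengths 2n - p - q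
  -- over p, q < n gives exactly n^3 + n^2.
  let T : Finset (Σ _ : ℕ × ℕ, ℕ) := (Finset.range n ×ˢ Finset.range n).sigma
    fun p => Finset.Ico p.2 (2 * n - p.1)
  have hcard : T.card ≤ n ^ 3 + n ^ 2 := by
    have hT : (T.card : ℚ) = ∑ a ∈ Finset.range n, ∑ b ∈ Finset.range n, (2 * (n : ℚ) - a - b) := by
      simp only [T]
      rw [Finset.card_sigma, Finset.sum_product]
      push_cast
      refine Finset.sum_congr rfl fun a ha => Finset.sum_congr rfl fun b hb => ?_
      rw [Finset.mem_range] at ha hb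
      rw [Nat.card_Ico, Nat.cast_sub (by omega), Nat.cast_sub (by omega)]
      push_cast
      ring
    have hid : ∑ a ∈ Finset.range n, (a : ℚ) = n * (n - 1) / 2 := by
      clear hT T hA
      induction n with
      | zero => simp
      | succ n ih =>
        rw [Finset.sum_range_succ, ih]
        push_cast
        ring
    have : (T.card : ℚ) = n ^ 3 + n ^ 2 := by
      rw [hT]
      simp only [Finset.sum_sub_distrib, Finset.sum_const, Finset.card_range, nsmul_eq_mul, hid,
        ← Finset.mul_sum]
      ring
    exact_mod_cast this.le
  refine le_trans ?_ hcard
  rw [← Set.ncard_coe_finset]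
  refine Set.ncard_le_ncard_of_injOn (fun s => ⟨(s 0 - s 1, s 1 - s 2), s 1⟩) (fun s hs => ?_) ?_
    (Finset.finite_toSet _)
  · obtain ⟨a, b, c, d, h1, h2, h3, h4, rfl⟩ := hA s hs
    simp [T]
    omega
  · intro s hs s' hs' h
    obtain ⟨a, b, c, d, h1, h2, h3, h4, rfl⟩ := hA s hs
    obtain ⟨a', b', c', d', h1', h2', h3', h4', rfl⟩ := hA s' hs'
    simp at h
    have e0 : a + b = a' + b' := by omega
    have e1 : b + c = b' + c' := by omega
    have e2 : c + d = c' + d' := by omega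
    rw [e0, e1, e2]

/-- This makes the leading coefficient at most 1. It fails at `m = 3`, where 8 > 6, so `r = 4` is
treated separately. -/
theorem two_pow_le_factorial {m : ℕ} (hm : 4 ≤ m) : 2 ^ m ≤ m.factorial := by
  induction m, hm using Nat.le_induction with
  | base => decide
  | succ k hk ih =>
    rw [pow_succ, Nat.factorial_succ, mul_comm]
    exact Nat.mul_le_mul (by omega) ih

/-! ### Bounds for `pmd` and the theorem -/

namespace Hypergraph

theorem IsUniform.pmd_le_choose {α : Type*} {H : Hypergraph α} {n m : ℕ}
    (hV : H.vertexSet.encard = n) (hm : 1 ≤ m) (hH : H.IsUniform (m + 1)) :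
    H.pmd ≤ (2 * n).choose m := by
  obtain ⟨v, hv, hle⟩ := hH.exists_pmd_le_ncard hV hm
  refine hle.trans (ncard_strictAnti_le_choose ?_)
  rintro _ ⟨e, he, rfl⟩
  obtain ⟨h1, h2⟩ := hv e he
  refine ⟨fun j k hjk => ?_, fun k => ?_⟩
  · have hjk' : (j : ℕ) < k := hjk
    have h3 := h1 j k hjk' (by omega)
    have h4 := h1 (j + 1) (k + 1) (by omega) (by omega)
    change v e k + v e (k + 1) < v e j + v e (j + 1)
    omega
  · have h3 := h2 k (by omega)
    have h4 := h2 (k + 1) (by omega)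
    change v e k + v e (k + 1) < 2 * n
    omega

theorem IsUniform.pmd_le_of_four {α : Type*} {H : Hypergraph α} {n : ℕ}
    (hV : H.vertexSet.encard = n) (hH : H.IsUniform 4) : H.pmd ≤ n ^ 3 + n ^ 2 := by
  obtain ⟨v, hv, hle⟩ := IsUniform.exists_pmd_le_ncard (m := 3) hV (by omega) hH
  refine hle.trans (ncard_sums_quadruples_le ?_)
  rintro _ ⟨e, he, rfl⟩
  obtain ⟨h1, h2⟩ := hv e he
  refine ⟨v e 0, v e 1, v e 2, v e 3, h1 2 3 (by omega) (by omega), h1 1 2 (by omega) (by omega),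
    h1 0 1 (by omega) (by omega), h2 0 (by omega), ?_⟩
  funext k
  fin_cases k <;> rfl

theorem IsUniform.pmd_le_two_pow_div_factorial_mul {α : Type*} {H : Hypergraph α} {n m : ℕ}
    (hV : H.vertexSet.encard = n) (hm : 1 ≤ m) (hH : H.IsUniform (m + 1)) :
    (H.pmd : ℚ) ≤ 2 ^ m / m.factorial * (n : ℚ) ^ m := by
  have h1 : (H.pmd : ℚ) ≤ ((2 * n).choose m : ℕ) := by exact_mod_cast hH.pmd_le_choose hV hm
  refine (h1.trans (Nat.choose_le_pow_div m (2 * n))).trans_eq ?_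
  push_cast
  rw [mul_pow]
  ring

end Hypergraph

theorem mainTheorem4 (r : ℕ) (hr : 2 ≤ r) :
    (4 ≤ r → ∃ q : ℚ[X], q.natDegree ≤ r - 2 ∧
      ∀ (α : Type u) (H : Hypergraph α) (n : ℕ), H.vertexSet.encard = n →
        H.IsUniform r → (H.pmd : ℚ) ≤ (n : ℚ) ^ (r - 1) + q.eval (n : ℚ)) ∧
    (∃ P : ℚ[X], P.natDegree ≤ r - 1 ∧
      ∀ (α : Type u) (H : Hypergraph α) (n : ℕ), H.vertexSet.encard = n →
        H.IsUniform r → (H.pmd : ℚ) ≤ P.eval (n : ℚ)) := by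
  obtain ⟨m, rfl⟩ : ∃ m, r = m + 1 := ⟨r - 1, by omega⟩
  simp only [Nat.add_sub_cancel]
  refine ⟨fun h4 => ?_, C (2 ^ m / (m.factorial : ℚ)) * X ^ m, natDegree_C_mul_X_pow_le _ _, ?_⟩
  · rcases eq_or_lt_of_le h4 with h | h
    · obtain rfl : m = 3 := by omega
      refine ⟨X ^ 2, (natDegree_X_pow_le 2), fun α H n hV hH => ?_⟩
      rw [eval_pow, eval_X]
      exact_mod_cast hH.pmd_le_of_four hV
    -- For `r ≥ 5` no correction term is needed: 2^m / m! ≤ 1 already.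
    · refine ⟨0, by simp, fun α H n hV hH => ?_⟩
      rw [eval_zero, add_zero]
      refine (hH.pmd_le_two_pow_div_factorial_mul hV (by omega)).trans
        (mul_le_of_le_one_left (by positivity) ?_)
      rw [div_le_one (by positivity)]
      exact_mod_cast two_pow_le_factorial (m := m) (by omega)
  · intro α H n hV hH
    rw [eval_mul, eval_C, eval_pow, eval_X]
    exact hH.pmd_le_two_pow_div_factorial_mul hV (by omega)
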